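/- Let $X$ be a nonempty compact Hausdorff space, $\mathcal L_{\sf H}$ a first-order language (the home sort $\sf H$), and $\mathcal L$ the two-sorted language extending $\mathcal L_{\sf H}$ whose second sort $\sf S$ (the space sort) has a predicate for every closed $C\subseteq X^k$ ($k\ge 1$) and a function symbol for every continuous $f\colon X^k\to X$ ($k\ge 0$), and which has in addition a given collection of function symbols of sort ${\sf H}^k\to{\sf S}$ ($k\ge1$). A standard structure is an $\mathcal L$-structure $\langle M,X\rangle$ in which the symbols of sort $\sf S$ have their natural interpretation in $X$. The class $\mathcal F$ is the least class of $\mathcal L$-formulas that contains all $\mathcal L_{\sf H}$-formulas and all formulas $t\in C$, where $C\subseteq X^k$ is closed ($k\ge1$) and $t$ is a $k$-tuple of terms with values in $\sf S$, and that is closed under $\wedge$, $\vee$ and under the quantifiers $\forall,\exists$ of both sorts. $\mathcal H\subseteq\mathcal F$ consists of the formulas without quantifiers of sort $\sf S$. For a set $A\subseteq M$, $\mathcal F(A)$ and $\mathcal H(A)$ are the corresponding classes for the language with names for the elements of $A$. An approximation $\varphi'>\varphi$ of an $\mathcal F(A)$-formula $\varphi$ is obtained by replacing each occurrence in $\varphi$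 of an atomic formula $t\in C$ by $t\in C'$ for some closed neighbourhood $C'$ of $C$ (that is, $C'$ is closed and $C\subseteq\operatorname{int}C'$). A standard structure $\langle M,X\rangle$ is $\mathcal F$-saturated if every set $p(x;\eta)$ of $\mathcal F(B)$-formulas in finitely many free variables $x$ of sort $\sf H$ and $\eta$ of sort $\sf S$, where $B\subseteq M$ and $|B|<|M|$, is realized in $\langle M,X\rangle$ as soon as each of its finite subsets is. Let $\langle\mathcal U,X\rangle$ be an $\mathcal F$-saturated standard structure with $\mathcal U$ infinite (the monster model), and let $A\subseteq\mathcal U$ with $|A|<|\mathcal U|$. Then for every $\varphi(x;\eta)\in\mathcal F(A)$, with $x$ and $\eta$ finite tuples of variables of sort $\sf H$ and $\sf S$, and for every approximation $\varphi'>\varphi$, there is $\psi(x;\eta)\in\mathcal H(A)$ such that $$\varphi(x;\eta)\rightarrow\psi(x;\eta)\rightarrow\varphi'(x;\eta)$$ holds in $\langle\mathcal U,X\rangle$ for all values of $x$ in $\mathcal U$ and of $\eta$ in $X$. -/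

import Mathlib

open FirstOrder TopologicalSpace
open scoped Cardinal

namespace TwoSorted

universe u v w x y

/-- The part of a standard structure `⟨M, X⟩` that connects the two sorts: every symbol in `K n` is a
function symbol of sort `H ^ (n + 1) → S`, interpreted as a function from `M ^ (n + 1)` to `X`.
A standard structure consists of a home sort `M` with `[L.Structure M]`, the fixed space `X` (in which
closed sets and continuous functions are interpreted as themselves), and `[MixedStructure K X M]`. -/
class MixedStructure (K : ℕ → Type w) (X : Type x) (M : Type y) where
  /-- The interpretation of a function symbol of sort `H ^ (n + 1) → S`. -/
  mixedMap : ∀ {n : ℕ}, K n → (Fin (n + 1) → M) → X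

/-- Terms `t(x ; η)` of sort `H ^ n × S ^ m → S`. -/
inductive SpaceTerm (L : FirstOrder.Language.{u, v}) (K : ℕ → Type w) (X : Type x) [TopologicalSpace X]
    (n m : ℕ) : Type (max u w x)
  /-- a variable of sort `S` -/
  | var (i : Fin m) : SpaceTerm L K X n m
  /-- a continuous function `X ^ k → X` applied to terms of sort `S` (a constant when `k = 0`) -/
  | cont {k : ℕ} (f : C(Fin k → X, X)) (t : Fin k → SpaceTerm L K X n m) : SpaceTerm L K X n m
  /-- a function symbol of sort `H ^ (k + 1) → S` applied to terms of sort `H` -/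
  | mixed {k : ℕ} (g : K k) (t : Fin (k + 1) → L.Term (Fin n)) : SpaceTerm L K X n m

/-- The formulas `φ(x ; η)` of the class `F`, with `n` free variables of sort `H` and `m` free
variables of sort `S`. Quantifiers bind the last variable of their sort. -/
inductive FFormula (L : FirstOrder.Language.{u, v}) (K : ℕ → Type w) (X : Type x) [TopologicalSpace X] :
    ℕ → ℕ → Type (max u v w x)
  /-- an arbitrary first-order formula of the language of the home sort -/
  | home {n m : ℕ} (φ : L.Formula (Fin n)) : FFormula L K X n m
  /-- `t ∈ C` for a closed set `C ⊆ X ^ (k + 1)` and a tuple `t` of terms of sort `S` -/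
  | mem {n m k : ℕ} (t : Fin (k + 1) → SpaceTerm L K X n m) (C : Closeds (Fin (k + 1) → X)) :
      FFormula L K X n m
  | and {n m : ℕ} (φ ψ : FFormula L K X n m) : FFormula L K X n m
  | or {n m : ℕ} (φ ψ : FFormula L K X n m) : FFormula L K X n m
  | allHome {n m : ℕ} (φ : FFormula L K X (n + 1) m) : FFormula L K X n m
  | exHome {n m : ℕ} (φ : FFormula L K X (n + 1) m) : FFormula L K X n m
  | allSpace {n m : ℕ} (φ : FFormula L K X n (m + 1)) : FFormula L K X n m
  | exSpace {n m : ℕ} (φ : FFormula L K X n (m + 1)) : FFormula L K X n m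

section Semantics

variable {L : FirstOrder.Language.{u, v}} {K : ℕ → Type w} {X : Type x} [TopologicalSpace X]
  {M : Type y} [L.Structure M] [MixedStructure K X M]

/-- The value of a term of sort `S` in the standard structure `⟨M, X⟩`. -/
def SpaceTerm.realize {n m : ℕ} (a : Fin n → M) (α : Fin m → X) : SpaceTerm L K X n m → X
  | .var i => α i
  | .cont f t => f fun i => (t i).realize a α
  | .mixed g t => MixedStructure.mixedMap g fun i => (t i).realize a

/-- Truth of `φ(a ; α)` in the standard structure `⟨M, X⟩`. -/
def FFormula.Realize : {n m : ℕ} → FFormula L K X n m → (Fin n → M) → (Fin m → X) → Prop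
  | _, _, .home φ, a, _ => φ.Realize a
  | _, _, .mem t C, a, α => (fun i => (t i).realize a α) ∈ C
  | _, _, .and φ ψ, a, α => φ.Realize a α ∧ ψ.Realize a α
  | _, _, .or φ ψ, a, α => φ.Realize a α ∨ ψ.Realize a α
  | _, _, .allHome φ, a, α => ∀ b : M, φ.Realize (Fin.snoc a b : Fin (_ + 1) → M) α
  | _, _, .exHome φ, a, α => ∃ b : M, φ.Realize (Fin.snoc a b : Fin (_ + 1) → M) α
  | _, _, .allSpace φ, a, α => ∀ β : X, φ.Realize a (Fin.snoc α β : Fin (_ + 1) → X)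
  | _, _, .exSpace φ, a, α => ∃ β : X, φ.Realize a (Fin.snoc α β : Fin (_ + 1) → X)

/-- The formula belongs to the class `H`: it contains no quantifier of sort `S`. -/
def FFormula.IsH : {n m : ℕ} → FFormula L K X n m → Prop
  | _, _, .home _ => True
  | _, _, .mem _ _ => True
  | _, _, .and φ ψ => φ.IsH ∧ ψ.IsH
  | _, _, .or φ ψ => φ.IsH ∧ ψ.IsH
  | _, _, .allHome φ => φ.IsH
  | _, _, .exHome φ => φ.IsH
  | _, _, .allSpace _ => False
  | _, _, .exSpace _ => False

/-- `φ.Approx φ'` means that `φ'` is an approximation of `φ`, written `φ' > φ`: each occurrence of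
an atomic formula `t ∈ C` in `φ` is replaced by `t ∈ C'` for some closed neighbourhood `C'` of `C`,
and nothing else is changed. -/
inductive FFormula.Approx : {n m : ℕ} → FFormula L K X n m → FFormula L K X n m → Prop
  | home {n m : ℕ} (φ : L.Formula (Fin n)) :
      Approx (.home φ : FFormula L K X n m) (.home φ)
  | mem {n m k : ℕ} (t : Fin (k + 1) → SpaceTerm L K X n m) (C C' : Closeds (Fin (k + 1) → X))
      (h : (C : Set (Fin (k + 1) → X)) ⊆ interior (C' : Set (Fin (k + 1) → X))) :
      Approx (.mem t C) (.mem t C')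
  | and {n m : ℕ} {φ φ' ψ ψ' : FFormula L K X n m} (hφ : Approx φ φ') (hψ : Approx ψ ψ') :
      Approx (.and φ ψ) (.and φ' ψ')
  | or {n m : ℕ} {φ φ' ψ ψ' : FFormula L K X n m} (hφ : Approx φ φ') (hψ : Approx ψ ψ') :
      Approx (.or φ ψ) (.or φ' ψ')
  | allHome {n m : ℕ} {φ φ' : FFormula L K X (n + 1) m} (h : Approx φ φ') :
      Approx (.allHome φ) (.allHome φ')
  | exHome {n m : ℕ} {φ φ' : FFormula L K X (n + 1) m} (h : Approx φ φ') :
      Approx (.exHome φ) (.exHome φ')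
  | allSpace {n m : ℕ} {φ φ' : FFormula L K X n (m + 1)} (h : Approx φ φ') :
      Approx (.allSpace φ) (.allSpace φ')
  | exSpace {n m : ℕ} {φ φ' : FFormula L K X n (m + 1)} (h : Approx φ φ') :
      Approx (.exSpace φ) (.exSpace φ')

end Semantics

/-- `⟨M, X⟩` is `κ`-`F`-saturated: every type `p(x ; η) ⊆ F(B)` over a set `B ⊆ M` of fewer than
`κ` parameters that is finitely realized in `⟨M, X⟩` is realized in `⟨M, X⟩`. Here `F(B)` is the
class `F` for the language `L[[B]]`, with a name for each element of `B`. -/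
def IsFSaturated (L : FirstOrder.Language.{u, v}) (K : ℕ → Type w) (X : Type x) [TopologicalSpace X]
    (M : Type y) [L.Structure M] [MixedStructure K X M] (κ : Cardinal.{y}) : Prop :=
  ∀ B : Set M, #B < κ → ∀ (n m : ℕ) (p : Set (FFormula (L[[B]]) K X n m)),
    (∀ s : Finset (FFormula (L[[B]]) K X n m), (s : Set (FFormula (L[[B]]) K X n m)) ⊆ p →
      ∃ (a : Fin n → M) (α : Fin m → X), ∀ φ ∈ s, φ.Realize a α) →
    ∃ (a : Fin n → M) (α : Fin m → X), ∀ φ ∈ p, φ.Realize a α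

end TwoSorted

/-!
By compactness of `X`, a quantifier of sort `S` can be replaced by a finite disjunction or
conjunction over a sufficiently fine finite net of points of `X`, each of which is named by a
constant of the language.

Equip `X` with its unique compatible uniformity. Function symbols with arguments of sort `S` are
continuous on a compact power of `X`, hence uniformly continuous, and symbols of sort `H ^ k → S`
do not see the variables of sort `S`; so the terms `t(a ; -)` are uniformly equicontinuous as `a`
varies (`TwoSorted.SpaceTerm.exists_entourage`). This makes the following strengthening of the
theorem provable by induction on `φ' > φ` (`TwoSorted.FFormula.Approx.exists_isH_entourage`): there
are `ψ` without quantifiers of sort `S` and an entourage `W` such that, for all `a` and all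
coordinatewise `W`-close `α` and `β`,
`φ(a ; α)` implies `ψ(a ; β)`, and `ψ(a ; α)` implies `φ'(a ; β)`.

At a quantifier of sort `S`, let `ψ(x ; ξ, η)` and `W` be given for the matrix and let `T` be a finite
`W`-net of `X`. Then `⋁ c ∈ T, ψ(x ; ξ, c)` works for `∃ η` and `⋀ c ∈ T, ψ(x ; ξ, c)` works for
`∀ η`: the freedom to move from `α` to `β` in the induction hypothesis is what allows an arbitrary
value of `η` to be exchanged for a point of the net. The theorem is the case `α = β`.
-/

open Uniformity

namespace TwoSorted

universe u v w x y

section Substitution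

variable {L : FirstOrder.Language.{u, v}} {K : ℕ → Type w} {X : Type x} [TopologicalSpace X]
  {M : Type y} [L.Structure M] [MixedStructure K X M]

/-! ### Substitution and finite Boolean combinations -/

/-- Substitution in a term: `s` is a change of the variables of sort `S` each coordinate of which
is the value of a term. -/
theorem SpaceTerm.exists_subst {n m m' : ℕ} {s : (Fin m' → X) → Fin m → X}
    (hs : ∀ i, ∃ t : SpaceTerm L K X n m', ∀ (a : Fin n → M) α, t.realize a α = s α i)
    (t : SpaceTerm L K X n m) :
    ∃ t' : SpaceTerm L K X n m', ∀ (a : Fin n → M) α, t'.realize a α = t.realize a (s α) := by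
  induction t with
  | var i => exact hs i
  | cont f t ih =>
    choose t' ht' using ih
    exact ⟨.cont f t', fun a α => by simp [SpaceTerm.realize, ht']⟩
  | mixed g t => exact ⟨.mixed g t, fun a α => rfl⟩

/-- Substitution in a formula without quantifiers of sort `S`. The coordinates of `s` have to be
terms over every number of variables of sort `H`, because quantifiers of that sort are crossed. -/
theorem FFormula.IsH.exists_subst {n m m' : ℕ} {s : (Fin m' → X) → Fin m → X}
    (hs : ∀ n i, ∃ t : SpaceTerm L K X n m', ∀ (a : Fin n → M) α, t.realize a α = s α i)
    {ψ : FFormula L K X n m} (hψ : ψ.IsH) :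
    ∃ χ : FFormula L K X n m', χ.IsH ∧
      ∀ (a : Fin n → M) α, χ.Realize a α ↔ ψ.Realize a (s α) := by
  induction ψ with
  | home φ => exact ⟨.home φ, trivial, fun a α => Iff.rfl⟩
  | mem t C =>
    choose t' ht' using fun i => (t i).exists_subst (M := M) (hs _)
    exact ⟨.mem t' C, trivial, fun a α => by simp [FFormula.Realize, ht']⟩
  | and φ ψ ihφ ihψ =>
    obtain ⟨φ', hφ', h₁⟩ := ihφ hs hψ.1
    obtain ⟨ψ', hψ', h₂⟩ := ihψ hs hψ.2
    exact ⟨.and φ' ψ', ⟨hφ', hψ'⟩, fun a α => and_congr (h₁ a α) (h₂ a α)⟩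
  | or φ ψ ihφ ihψ =>
    obtain ⟨φ', hφ', h₁⟩ := ihφ hs hψ.1
    obtain ⟨ψ', hψ', h₂⟩ := ihψ hs hψ.2
    exact ⟨.or φ' ψ', ⟨hφ', hψ'⟩, fun a α => or_congr (h₁ a α) (h₂ a α)⟩
  | allHome φ ih =>
    obtain ⟨φ', hφ', h⟩ := ih hs hψ
    exact ⟨.allHome φ', hφ', fun a α => forall_congr' fun b => h _ α⟩
  | exHome φ ih =>
    obtain ⟨φ', hφ', h⟩ := ih hs hψ
    exact ⟨.exHome φ', hφ', fun a α => exists_congr fun b => h _ α⟩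
  | allSpace φ => exact hψ.elim
  | exSpace φ => exact hψ.elim

/-- The formula `ψ(x ; ξ, c)` for a point `c` of `X`. -/
theorem FFormula.IsH.exists_substLast {n m : ℕ} {ψ : FFormula L K X n (m + 1)} (hψ : ψ.IsH)
    (c : X) :
    ∃ χ : FFormula L K X n m, χ.IsH ∧ ∀ (a : Fin n → M) (α : Fin m → X),
      χ.Realize a α ↔ ψ.Realize a (Fin.snoc α c : Fin (m + 1) → X) := by
  refine hψ.exists_subst (s := fun α => (Fin.snoc α c : Fin (m + 1) → X)) fun n i => ?_
  induction i using Fin.lastCases with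
  | last => exact ⟨.cont (k := 0) (.const _ c) Fin.elim0, fun a α => by simp [SpaceTerm.realize]⟩
  | cast i => exact ⟨.var i, fun a α => by simp [SpaceTerm.realize]⟩

theorem FFormula.exists_isH_finset_or {ι : Type*} {n m : ℕ} (T : Finset ι)
    {ψ : ι → FFormula L K X n m} (hψ : ∀ i, (ψ i).IsH) :
    ∃ χ : FFormula L K X n m, χ.IsH ∧
      ∀ (a : Fin n → M) α, χ.Realize a α ↔ ∃ i ∈ T, (ψ i).Realize a α := by
  classical
  induction T using Finset.induction_on with
  | empty => exact ⟨.home ⊥, trivial, fun a α => by simp [FFormula.Realize]⟩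
  | insert i T _ ih =>
    obtain ⟨χ, hχ, h⟩ := ih
    exact ⟨.or (ψ i) χ, ⟨hψ i, hχ⟩, fun a α => by simp [FFormula.Realize, h]⟩

theorem FFormula.exists_isH_finset_and {ι : Type*} {n m : ℕ} (T : Finset ι)
    {ψ : ι → FFormula L K X n m} (hψ : ∀ i, (ψ i).IsH) :
    ∃ χ : FFormula L K X n m, χ.IsH ∧
      ∀ (a : Fin n → M) α, χ.Realize a α ↔ ∀ i ∈ T, (ψ i).Realize a α := by
  classical
  induction T using Finset.induction_on with
  | empty => exact ⟨.home ⊤, trivial, fun a α => by simp [FFormula.Realize]⟩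
  | insert i T _ ih =>
    obtain ⟨χ, hχ, h⟩ := ih
    exact ⟨.and (ψ i) χ, ⟨hψ i, hχ⟩, fun a α => by simp [FFormula.Realize, h]⟩

end Substitution

/-! ### Uniform equicontinuity of terms -/

theorem exists_entourage_pi {ι : Type*} [Finite ι] {X : Type x} [UniformSpace X]
    {V : Set ((ι → X) × (ι → X))} (hV : V ∈ 𝓤 (ι → X)) :
    ∃ W ∈ 𝓤 X, ∀ α β : ι → X, (∀ i, (α i, β i) ∈ W) → (α, β) ∈ V := by
  rw [Pi.uniformity, Filter.mem_iInf_of_finite] at hV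
  obtain ⟨S, hS, rfl⟩ := hV
  choose W hW hWS using fun i => Filter.mem_comap.1 (hS i)
  exact ⟨⋂ i, W i, Filter.iInter_mem.2 hW, fun α β h =>
    Set.mem_iInter.2 fun i => hWS i (Set.mem_iInter.1 (h i) i)⟩

theorem snoc_mem_of_mem {X : Type x} {m : ℕ} {W : Set (X × X)} {α β : Fin m → X} {c d : X}
    (h : ∀ i, (α i, β i) ∈ W) (hcd : (c, d) ∈ W) (i : Fin (m + 1)) :
    ((Fin.snoc α c : Fin (m + 1) → X) i, (Fin.snoc β d : Fin (m + 1) → X) i) ∈ W := by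
  induction i using Fin.lastCases with
  | last => simpa using hcd
  | cast i => simpa using h i

section Uniform

variable {L : FirstOrder.Language.{u, v}} {K : ℕ → Type w} {X : Type x} [UniformSpace X]
  [CompactSpace X] {M : Type y} [L.Structure M] [MixedStructure K X M]

/-- The functions `t(a ; -)`, for `a` in the home sort, are uniformly equicontinuous. -/
theorem SpaceTerm.exists_entourage {n m : ℕ} (t : SpaceTerm L K X n m) {V : Set (X × X)}
    (hV : V ∈ 𝓤 X) :
    ∃ W ∈ 𝓤 X, ∀ (a : Fin n → M) (α β : Fin m → X), (∀ i, (α i, β i) ∈ W) →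
      (t.realize a α, t.realize a β) ∈ V := by
  induction t generalizing V with
  | var i => exact ⟨V, hV, fun a α β h => h i⟩
  | cont f t ih =>
    obtain ⟨V', hV', hf⟩ := exists_entourage_pi
      (CompactSpace.uniformContinuous_of_continuous f.continuous hV)
    choose W hW h using fun i => ih i hV'
    exact ⟨⋂ i, W i, Filter.iInter_mem.2 hW, fun a α β hαβ =>
      hf _ _ fun i => h i a α β fun j => Set.mem_iInter.1 (hαβ j) i⟩
  | mixed g t => exact ⟨Set.univ, Filter.univ_mem, fun a α β _ => refl_mem_uniformity hV⟩

theorem SpaceTerm.exists_entourage_tuple {n m k : ℕ} (t : Fin k → SpaceTerm L K X n m)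
    {C O : Set (Fin k → X)} (hC : IsClosed C) (hO : IsOpen O) (hCO : C ⊆ O) :
    ∃ W ∈ 𝓤 X, ∀ (a : Fin n → M) (α β : Fin m → X), (∀ i, (α i, β i) ∈ W) →
      (fun i => (t i).realize a α) ∈ C → (fun i => (t i).realize a β) ∈ O := by
  obtain ⟨V, hV, -, hVO⟩ := lebesgue_number_of_compact_open hC.isCompact hO hCO
  obtain ⟨V', hV', hVV'⟩ := exists_entourage_pi hV
  choose W hW h using fun i => (t i).exists_entourage (M := M) hV'
  exact ⟨⋂ i, W i, Filter.iInter_mem.2 hW, fun a α β hαβ hα => hVO _ hα <|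
    hVV' _ _ fun i => h i a α β fun j => Set.mem_iInter.1 (hαβ j) i⟩

/-! ### Elimination of the quantifiers of the space sort -/

/-- A finite `W`-net of a compact space, for a relation `W` used in both directions. -/
theorem exists_finset_net {W : Set (X × X)} (hW : W ∈ 𝓤 X) :
    ∃ T : Finset X, ∀ β : X, ∃ c ∈ T, (β, c) ∈ W ∧ (c, β) ∈ W := by
  obtain ⟨T, -, hT⟩ := isCompact_univ.elim_nhds_subcover
    (fun c : X => {β | (β, c) ∈ W ∧ (c, β) ∈ W})
    fun c _ => Filter.inter_mem (mem_nhds_right c hW) (mem_nhds_left c hW)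
  refine ⟨T, fun β => ?_⟩
  simpa [and_left_comm] using hT (Set.mem_univ β)

/-- The elimination of the quantifiers of sort `S`, with a tolerance `W` in the variables of sort
`S` that carries the induction through those quantifiers. -/
theorem FFormula.Approx.exists_isH_entourage [T2Space X] {n m : ℕ} {φ φ' : FFormula L K X n m}
    (hφ : φ.Approx φ') :
    ∃ ψ : FFormula L K X n m, ψ.IsH ∧ ∃ W ∈ 𝓤 X, ∀ (a : Fin n → M) (α β : Fin m → X),
      (∀ i, (α i, β i) ∈ W) →
        (φ.Realize a α → ψ.Realize a β) ∧ (ψ.Realize a α → φ'.Realize a β) := by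
  induction hφ with
  | home φ => exact ⟨.home φ, trivial, Set.univ, Filter.univ_mem, fun a α β _ => ⟨id, id⟩⟩
  | mem t C C' h =>
    -- A closed neighbourhood of `C` inside the interior of `C'` leaves room on both sides.
    obtain ⟨O, hO, hCO, hOC'⟩ := normal_exists_closure_subset C.isClosed isOpen_interior h
    obtain ⟨W₁, hW₁, h₁⟩ := SpaceTerm.exists_entourage_tuple (M := M) t C.isClosed hO hCO
    obtain ⟨W₂, hW₂, h₂⟩ :=
      SpaceTerm.exists_entourage_tuple (M := M) t isClosed_closure isOpen_interior hOC'
    exact ⟨.mem t ⟨closure O, isClosed_closure⟩, trivial, W₁ ∩ W₂, Filter.inter_mem hW₁ hW₂,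
      fun a α β hαβ => ⟨fun hα => subset_closure (h₁ a α β (fun i => (hαβ i).1) hα),
        fun hα => interior_subset (h₂ a α β (fun i => (hαβ i).2) hα)⟩⟩
  | and _ _ ihφ ihψ =>
    obtain ⟨χ₁, hχ₁, W₁, hW₁, h₁⟩ := ihφ
    obtain ⟨χ₂, hχ₂, W₂, hW₂, h₂⟩ := ihψ
    refine ⟨.and χ₁ χ₂, ⟨hχ₁, hχ₂⟩, W₁ ∩ W₂, Filter.inter_mem hW₁ hW₂, fun a α β hαβ => ?_⟩
    have h₁ := h₁ a α β fun i => (hαβ i).1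
    have h₂ := h₂ a α β fun i => (hαβ i).2
    exact ⟨And.imp h₁.1 h₂.1, And.imp h₁.2 h₂.2⟩
  | or _ _ ihφ ihψ =>
    obtain ⟨χ₁, hχ₁, W₁, hW₁, h₁⟩ := ihφ
    obtain ⟨χ₂, hχ₂, W₂, hW₂, h₂⟩ := ihψ
    refine ⟨.or χ₁ χ₂, ⟨hχ₁, hχ₂⟩, W₁ ∩ W₂, Filter.inter_mem hW₁ hW₂, fun a α β hαβ => ?_⟩
    have h₁ := h₁ a α β fun i => (hαβ i).1
    have h₂ := h₂ a α β fun i => (hαβ i).2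
    exact ⟨Or.imp h₁.1 h₂.1, Or.imp h₁.2 h₂.2⟩
  | allHome _ ih =>
    obtain ⟨χ, hχ, W, hW, h⟩ := ih
    exact ⟨.allHome χ, hχ, W, hW, fun a α β hαβ =>
      ⟨fun hα b => (h _ α β hαβ).1 (hα b), fun hα b => (h _ α β hαβ).2 (hα b)⟩⟩
  | exHome _ ih =>
    obtain ⟨χ, hχ, W, hW, h⟩ := ih
    exact ⟨.exHome χ, hχ, W, hW, fun a α β hαβ =>
      ⟨fun ⟨b, hb⟩ => ⟨b, (h _ α β hαβ).1 hb⟩, fun ⟨b, hb⟩ => ⟨b, (h _ α β hαβ).2 hb⟩⟩⟩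
  | allSpace _ ih =>
    obtain ⟨χ, hχ, W, hW, h⟩ := ih
    obtain ⟨T, hT⟩ := exists_finset_net hW
    choose χc hχc hc using hχ.exists_substLast (M := M)
    obtain ⟨ψ, hψ, hψT⟩ := FFormula.exists_isH_finset_and (M := M) T hχc
    refine ⟨ψ, hψ, W, hW, fun a α β hαβ => ⟨fun hα => ?_, fun hα γ => ?_⟩⟩
    · exact (hψT a β).2 fun c _ => (hc c a β).2 <|
        (h a _ _ (snoc_mem_of_mem hαβ (refl_mem_uniformity hW))).1 (hα c)
    · obtain ⟨c, hcT, -, hcγ⟩ := hT γ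
      exact (h a _ _ (snoc_mem_of_mem hαβ hcγ)).2 ((hc c a α).1 ((hψT a α).1 hα c hcT))
  | exSpace _ ih =>
    obtain ⟨χ, hχ, W, hW, h⟩ := ih
    obtain ⟨T, hT⟩ := exists_finset_net hW
    choose χc hχc hc using hχ.exists_substLast (M := M)
    obtain ⟨ψ, hψ, hψT⟩ := FFormula.exists_isH_finset_or (M := M) T hχc
    refine ⟨ψ, hψ, W, hW, fun a α β hαβ => ⟨fun ⟨γ, hγ⟩ => ?_, fun hα => ?_⟩⟩
    · obtain ⟨c, hcT, hγc, -⟩ := hT γ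
      exact (hψT a β).2 ⟨c, hcT, (hc c a β).2 ((h a _ _ (snoc_mem_of_mem hαβ hγc)).1 hγ)⟩
    · obtain ⟨c, -, hcα⟩ := (hψT a α).1 hα
      exact ⟨c, (h a _ _ (snoc_mem_of_mem hαβ (refl_mem_uniformity hW))).2 ((hc c a α).1 hcα)⟩

end Uniform

end TwoSorted

theorem mainTheorem6 {X : Type*} [TopologicalSpace X] [CompactSpace X] [T2Space X] [Nonempty X]
    (L : FirstOrder.Language) (K : ℕ → Type*)
    {U : Type*} [L.Structure U] [TwoSorted.MixedStructure K X U] [Infinite U]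
    (hU : TwoSorted.IsFSaturated L K X U (#U))
    (A : Set U) (hA : #A < #U) (n m : ℕ)
    (φ φ' : TwoSorted.FFormula (L[[A]]) K X n m) (hφ : φ.Approx φ') :
    ∃ ψ : TwoSorted.FFormula (L[[A]]) K X n m, ψ.IsH ∧
      (∀ (a : Fin n → U) (α : Fin m → X), φ.Realize a α → ψ.Realize a α) ∧
      (∀ (a : Fin n → U) (α : Fin m → X), ψ.Realize a α → φ'.Realize a α) := by
  let _ : UniformSpace X := uniformSpaceOfCompactR1
  obtain ⟨ψ, hψ, W, hW, h⟩ := hφ.exists_isH_entourage (M := U)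
  exact ⟨ψ, hψ, fun a α => (h a α α fun _ => refl_mem_uniformity hW).1,
    fun a α => (h a α α fun _ => refl_mem_uniformity hW).2⟩
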